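/- Let $\mathcal S$ be the set of real sequences $c=(c_0,c_1,c_2,\dots)$ with $c_m\ge 0$ for all $m$, $c_1\ge c_2\ge\cdots$ and $\sum_{m\ge0}c_m=1$, with the product $\sigma$-algebra; $c_0$ is called the active part. Let $W_1,W_2,\dots$ be independent and uniform on $[0,1]$. The Poisson–Dirichlet distribution with parameter $1$, PD$(1)$, is the law of the decreasing rearrangement $(Q_1,Q_2,\dots)$ of $(W_1,\,(1-W_1)W_2,\,(1-W_1)(1-W_2)W_3,\dots)$. Let $V$ be uniform on $[0,1]$ and independent of $(Q_1,Q_2,\dots)$, and let $I$ be the (almost surely unique) index with $\sum_{i=1}^{I-1}Q_i\le V<\sum_{i=1}^{I}Q_i$. Put $C_0=Q_I$ (a size-biased part), and let $(C_1,C_2,\dots)$ be the sequence of the remaining parts $Q_i$, $i\ne I$, in non-increasing order. Let $\mu$ be the law of $(C_0,C_1,C_2,\dots)$. For $c\in\mathcal S$ and $u\in[0,1]$ the split-and-merge transformation is the following. - Split: if $u\le c_0$, the new active part is $u$, and the new non-active parts are $c_0-u,c_1,c_2,\dots$ arranged in decreasing order. - Merge: if $u>c_0$ and $j\ge1$ is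 an index with $\sum_{m=0}^{j-1}c_m<u\le\sum_{m=0}^{j}c_m$, the new active part is $c_0+c_j$, and the new non-active parts are $c_1,\dots,c_{j-1},c_{j+1},c_{j+2},\dots$ in this order. (An index $j$ as required in the second case can fail to exist only for $u=1$; then $c$ is left unchanged.) **Theorem.** The law $\mu$ is a probability measure with $\mu(\mathcal S)=1$, and it is invariant under the split-and-merge transformation: if $C$ is a random sequence with law $\mu$ and $U$ is uniform on $[0,1]$ and independent of $C$, then the split-and-merge transform of $C$ driven by $U$ again has law $\mu$. -/

import Mathlib

open MeasureTheory ProbabilityTheory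

namespace Stirring

noncomputable section

/-- The set of ranked sequences `(c 0, c 1, c 2, …)`: nonnegative, of total mass one, with active
coordinate `c 0` and the remaining coordinates listed in non-increasing order. -/
def rankedStates : Set (ℕ → ℝ) :=
  {c | (∀ m, 0 ≤ c m) ∧ (∀ m n, 1 ≤ m → m ≤ n → c n ≤ c m) ∧ HasSum c 1}

/-- The uniform distribution on `[0, 1]`. -/
def uniform01 : Measure ℝ := volume.restrict (Set.Icc 0 1)

/-- Put `a` in front of the sequence `s`. -/
def cons (a : ℝ) (s : ℕ → ℝ) : ℕ → ℝ
  | 0 => a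
  | m + 1 => s m

/-- Delete the entry with index `j` from the sequence `s`, keeping the order of the others. -/
def delete (j : ℕ) (s : ℕ → ℝ) : ℕ → ℝ :=
  fun m => if m < j then s m else s (m + 1)

/-- The decreasing rearrangement of a nonnegative sequence tending to `0`: the entry with index `k`
is the least `x ≥ 0` such that at most `k` entries of `p` exceed `x`, that is, the `(k+1)`-st
largest entry of `p`, counted with multiplicity. -/
def decreasingRearrangement (p : ℕ → ℝ) : ℕ → ℝ :=
  fun k => sInf {x : ℝ | 0 ≤ x ∧ {i : ℕ | x < p i}.encard ≤ k}

/-- Stick breaking: `(W₁, (1 - W₁) W₂, (1 - W₁) (1 - W₂) W₃, …)`, indexed from `0`. -/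
def stickBreaking (w : ℕ → ℝ) : ℕ → ℝ :=
  fun k => (∏ i ∈ Finset.range k, (1 - w i)) * w k

/-- The Griffiths–Engen–McCloskey distribution with parameter `1`: the law of the stick breaking
sequence of independent uniform variables. -/
def gemOne : Measure (ℕ → ℝ) :=
  (Measure.infinitePi fun _ : ℕ => uniform01).map stickBreaking

/-- The Poisson–Dirichlet distribution with parameter `1`. -/
def poissonDirichletOne : Measure (ℕ → ℝ) :=
  gemOne.map decreasingRearrangement

/-- The index `i` with `q 0 + … + q (i-1) ≤ v < q 0 + … + q i`. When `q` is a probability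
distribution on `ℕ` and `0 ≤ v < 1`, there is exactly one such index. -/
def sizeBiasedIndex (q : ℕ → ℝ) (v : ℝ) : ℕ :=
  sInf {i : ℕ | v < ∑ k ∈ Finset.range (i + 1), q k}

/-- The sequence whose active coordinate is the part of `q` selected by `v`, followed by the
remaining parts of `q` in their order. -/
def activateSizeBiased (q : ℕ → ℝ) (v : ℝ) : ℕ → ℝ :=
  cons (q (sizeBiasedIndex q v)) (delete (sizeBiasedIndex q v) q)

/-- The distribution `μ`: the parts of a Poisson–Dirichlet(1) partition, where the active
coordinate is a size-biased part (selected by an independent uniform variable) and the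
remaining parts are in non-increasing order. -/
def stirringLaw : Measure (ℕ → ℝ) :=
  (poissonDirichletOne.prod uniform01).map fun x => activateSizeBiased x.1 x.2

/-- Split the active part at `u`: the new active part is `u`, and the fragment `c 0 - u` joins the
other parts, which are put into decreasing order again. -/
def split (c : ℕ → ℝ) (u : ℝ) : ℕ → ℝ :=
  cons u (decreasingRearrangement (cons (c 0 - u) fun m => c (m + 1)))

/-- Merge the active part with the part with index `j ≥ 1`. -/
def merge (c : ℕ → ℝ) (j : ℕ) : ℕ → ℝ :=
  fun m => if m = 0 then c 0 + c j else if m < j then c m else c (m + 1)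

/-- The index `j` with `c 0 + … + c (j-1) < u ≤ c 0 + … + c j`. -/
def mergeIndex (c : ℕ → ℝ) (u : ℝ) : ℕ :=
  sInf {j : ℕ | u ≤ ∑ m ∈ Finset.range (j + 1), c m}

open Classical in
/-- The split-and-merge transformation driven by `u`: split the active part at `u` if `u ≤ c 0`,
and otherwise merge it with the part that `u` selects. (If `u` selects no part, which for a
probability distribution `c` and `u ≤ 1` is possible only when `u = 1`, nothing is changed.) -/
def splitMerge (c : ℕ → ℝ) (u : ℝ) : ℕ → ℝ :=
  if u ≤ c 0 then split c u
  else if ∃ j : ℕ, u ≤ ∑ m ∈ Finset.range (j + 1), c m then merge c (mergeIndex c u)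
  else c

end

end Stirring

/-! The key fact is `stirringLaw_eq_uniformHeadLaw`: a size-biased part of PD(1) is uniform and,
given its value `y`, the other parts are `1 - y` times an independent PD(1) partition. Invariance
then reduces to an identity between integrals over a triangle.

For the key fact, sample from the stick-breaking sequence instead of its rearrangement; selection
proportional to size does not depend on the order of the parts. The first stick `w` is selected with
probability `w`. Otherwise a part is selected inside the remainder, which is a copy of the same
sequence scaled by `1 - w`. Swapping the first stick with the selected part
(`lintegral_triangle_swap`) turns this second case into total weight `1 - y` on active part `y`, and
the weights `y` and `1 - y` add to one. `lintegral_sum_sizeBiased_le` is the inductive form of this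
argument.

For invariance, condition on the active part `w`. A split at `u` leaves `u`, a fragment `w - u` and
a PD(1) partition of mass `1 - w`; integrating over `u ≤ w` gives weight `1 - y` to active part `y`
(`lintegral_triangle_sub`). A merge adds to `w` a size-biased part of the remainder, which by the
key fact is `(1 - w) * b` with `b` uniform; this gives weight `x` to active part `x`
(`lintegral_triangle_add`). Again the weights add to one. -/

namespace Stirring

open Filter Topology
open scoped ENNReal

/-! ### Sequences, level counts and decreasing rearrangement -/

/-- The sequence without its first entry. -/
def tail (s : ℕ → ℝ) : ℕ → ℝ := fun m => s (m + 1)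

/-- The increasing enumeration of the natural numbers different from `j`. -/
def skip (j m : ℕ) : ℕ := if m < j then m else m + 1

@[simp] lemma cons_zero (a : ℝ) (s : ℕ → ℝ) : cons a s 0 = a := rfl

@[simp] lemma cons_succ (a : ℝ) (s : ℕ → ℝ) (m : ℕ) : cons a s (m + 1) = s m := rfl

@[simp] lemma tail_cons (a : ℝ) (s : ℕ → ℝ) : tail (cons a s) = s := rfl

lemma smul_cons (r a : ℝ) (s : ℕ → ℝ) : r • cons a s = cons (r * a) (r • s) := by
  funext m; cases m <;> rfl

lemma delete_eq_comp_skip (j : ℕ) (s : ℕ → ℝ) : delete j s = s ∘ skip j := by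
  funext m
  simp only [delete, skip, Function.comp]
  split_ifs <;> rfl

lemma delete_smul (j : ℕ) (r : ℝ) (s : ℕ → ℝ) : delete j (r • s) = r • delete j s := by
  simp only [delete_eq_comp_skip]; rfl

lemma delete_zero (s : ℕ → ℝ) : delete 0 s = tail s := by
  funext m; simp [delete, tail]

lemma delete_succ_cons (j : ℕ) (a : ℝ) (s : ℕ → ℝ) :
    delete (j + 1) (cons a s) = cons a (delete j s) := by
  funext m
  rcases m with _ | m
  · simp [delete]
  · simp [delete]

lemma strictMono_skip (j : ℕ) : StrictMono (skip j) := by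
  intro a b h
  simp only [skip]
  split_ifs <;> omega

lemma range_skip (j : ℕ) : Set.range (skip j) = {j}ᶜ := by
  ext n
  simp only [Set.mem_range, Set.mem_compl_iff, Set.mem_singleton_iff, skip]
  constructor
  · rintro ⟨m, rfl⟩
    split_ifs <;> omega
  · intro h
    rcases lt_or_gt_of_ne h with h | h
    · exact ⟨n, by simp [h]⟩
    · exact ⟨n - 1, by rw [if_neg (by omega)]; omega⟩

lemma antitone_delete (j : ℕ) {s : ℕ → ℝ} (hs : Antitone s) : Antitone (delete j s) := by
  rw [delete_eq_comp_skip]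
  exact hs.comp_monotone (strictMono_skip j).monotone

/-- The singleton-or-empty set in `Fin 1` records whether the new entry exceeds the level, so the
count is additive without a case split. -/
lemma encard_lt_cons (a : ℝ) (s : ℕ → ℝ) (x : ℝ) :
    {i | x < cons a s i}.encard = {_i : Fin 1 | x < a}.encard + {i | x < s i}.encard := by
  have h : {i | x < cons a s i} =
      (fun i : Fin 1 => (i : ℕ)) '' {_i | x < a} ∪ Nat.succ '' {i | x < s i} := by
    ext i
    rcases i with _ | i
    · simp
    · simp
  rw [h, Set.encard_union_eq, Fin.val_injective.encard_image, Nat.succ_injective.encard_image]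
  rw [Set.disjoint_left]
  rintro _ ⟨i, _, rfl⟩ ⟨j, _, h⟩
  have := i.2
  simp only [Nat.succ_eq_add_one] at h
  omega

lemma encard_lt_delete (j : ℕ) (s : ℕ → ℝ) (x : ℝ) :
    {i | x < delete j s i}.encard = ({i | x < s i} \ {j}).encard := by
  rw [delete_eq_comp_skip, ← (strictMono_skip j).injective.encard_image]
  congr 1
  have : ({i | x < s i} \ {j} : Set ℕ) = {i | x < s i} ∩ Set.range (skip j) := by
    rw [range_skip]; rfl
  rw [this, ← Set.image_preimage_eq_inter_range]
  rfl

lemma encard_lt_comp (p : ℕ → ℝ) (σ : Equiv.Perm ℕ) (x : ℝ) :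
    {i | x < (p ∘ σ) i}.encard = {i | x < p i}.encard := by
  rw [← σ.injective.encard_image]
  congr 1
  exact σ.image_preimage {i | x < p i}

/-- The rearrangement sees a sequence only through its level counts. Identities between
rearrangements are proved by comparing counts, with no need to match permutations. -/
lemma decreasingRearrangement_congr {p q : ℕ → ℝ}
    (h : ∀ x, {i | x < p i}.encard = {i | x < q i}.encard) :
    decreasingRearrangement p = decreasingRearrangement q := by
  funext k
  simp only [decreasingRearrangement, h]

lemma decreasingRearrangement_of_antitone {p : ℕ → ℝ} (hp : Antitone p) (h0 : ∀ i, 0 ≤ p i) :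
    decreasingRearrangement p = p := by
  funext k
  have : {x : ℝ | 0 ≤ x ∧ {i : ℕ | x < p i}.encard ≤ k} = Set.Ici (p k) := by
    ext x
    simp only [Set.mem_ofPred_eq, Set.mem_Ici]
    constructor
    · rintro ⟨_, h⟩
      by_contra! hx
      have hsub : ((Finset.range (k + 1) : Finset ℕ) : Set ℕ) ⊆ {i | x < p i} := fun i hi =>
        hx.trans_le (hp (by simpa [Nat.lt_succ_iff] using hi))
      have := (Set.encard_le_encard hsub).trans h
      rw [Set.encard_coe_eq_coe_finsetCard, Finset.card_range, Nat.cast_le] at this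
      omega
    · intro h
      refine ⟨(h0 k).trans h, ?_⟩
      have hsub : {i | x < p i} ⊆ ((Finset.range k : Finset ℕ) : Set ℕ) := fun i hi => by
        by_contra hik
        exact absurd ((hp (by simpa using hik)).trans h) (not_le.2 hi)
      have := Set.encard_le_encard hsub
      rwa [Set.encard_coe_eq_coe_finsetCard, Finset.card_range] at this
  rw [decreasingRearrangement, this, csInf_Ici]

/-- Order the indices by decreasing value, ties by index. Since `p` is positive with limit `0`,
every index has only finitely many predecessors, and their number is its position. A zero entry
would have infinitely many predecessors if infinitely many others were positive. -/
lemma exists_perm_antitone {p : ℕ → ℝ} (hp : ∀ i, 0 < p i) (hl : Tendsto p atTop (𝓝 0)) :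
    ∃ σ : Equiv.Perm ℕ, Antitone (p ∘ σ) := by
  classical
  let r : ℕ → ℕ → Prop := fun i j => p j < p i ∨ (p i = p j ∧ i < j)
  have rtrans : ∀ {a b c}, r a b → r b c → r a c := by
    rintro a b c (h | ⟨h, h'⟩) (k | ⟨k, k'⟩)
    · exact Or.inl (k.trans h)
    · exact Or.inl (k ▸ h)
    · exact Or.inl (h ▸ k)
    · exact Or.inr ⟨h.trans k, h'.trans k'⟩
  have rirr : ∀ a, ¬ r a a := by
    rintro a (h | ⟨_, h⟩)
    · exact lt_irrefl _ h
    · exact lt_irrefl _ h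
  have rtot : ∀ a b, a ≠ b → r a b ∨ r b a := by
    intro a b hab
    rcases lt_trichotomy (p a) (p b) with h | h | h
    · exact Or.inr (Or.inl h)
    · rcases lt_or_gt_of_ne hab with h' | h'
      · exact Or.inl (Or.inr ⟨h, h'⟩)
      · exact Or.inr (Or.inr ⟨h.symm, h'⟩)
    · exact Or.inl (Or.inl h)
  have hfin : ∀ j, {i | r i j}.Finite := by
    intro j
    have h := (hl.eventually (gt_mem_nhds (hp j)))
    rw [← Nat.cofinite_eq_atTop] at h
    refine (Filter.eventually_cofinite.1 h).subset ?_
    rintro i (hi | ⟨hi, _⟩)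
    · exact not_lt.2 hi.le
    · exact not_lt.2 hi.ge
  let P : ℕ → Finset ℕ := fun j => (hfin j).toFinset
  have hP : ∀ i j, i ∈ P j ↔ r i j := fun i j => by simp [P]
  let rank : ℕ → ℕ := fun j => (P j).card
  have hlt : ∀ {i j}, r i j → rank i < rank j := by
    intro i j hij
    refine Finset.card_lt_card (Finset.ssubset_iff_of_subset ?_ |>.2 ⟨i, (hP _ _).2 hij, ?_⟩)
    · intro a ha
      exact (hP _ _).2 (rtrans ((hP _ _).1 ha) hij)
    · exact fun h => rirr _ ((hP _ _).1 h)
  have hinj : Function.Injective rank := by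
    intro a b hab
    by_contra hne
    rcases rtot a b hne with h | h
    · exact (hlt h).ne hab
    · exact (hlt h).ne' hab
  have hsurj : Function.Surjective rank := by
    intro n
    obtain ⟨m, hm⟩ : ∃ m, n < rank m := by
      by_contra! h
      exact Set.infinite_range_of_injective hinj
        ((Set.finite_Iic n).subset (by rintro _ ⟨m, rfl⟩; exact h m))
    -- The `rank m` predecessors of `m` have distinct ranks below `rank m`, so they fill all of
    -- these values.
    have hsub : (P m).image rank ⊆ Finset.range (rank m) := by
      intro a ha
      obtain ⟨i, hi, rfl⟩ := Finset.mem_image.1 ha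
      exact Finset.mem_range.2 (hlt ((hP _ _).1 hi))
    have heq := Finset.eq_of_subset_of_card_le hsub (by
      rw [Finset.card_image_of_injective _ hinj, Finset.card_range])
    have : n ∈ (P m).image rank := heq ▸ Finset.mem_range.2 hm
    obtain ⟨i, _, hi⟩ := Finset.mem_image.1 this
    exact ⟨i, hi⟩
  let e := Equiv.ofBijective rank ⟨hinj, hsurj⟩
  refine ⟨e.symm, fun a b hab => ?_⟩
  by_contra! h
  have h1 := hlt (i := e.symm b) (j := e.symm a) (Or.inl h)
  have h2 : ∀ n, rank (e.symm n) = n := fun n => e.apply_symm_apply n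
  rw [h2, h2] at h1
  omega

/-- The sequences of positive numbers with limit `0`: these have a decreasing rearrangement that
uses every entry. -/
def Rankable (p : ℕ → ℝ) : Prop := (∀ i, 0 < p i) ∧ Tendsto p atTop (𝓝 0)

lemma Rankable.smul {p : ℕ → ℝ} (hp : Rankable p) {r : ℝ} (hr : 0 < r) : Rankable (r • p) :=
  ⟨fun i => mul_pos hr (hp.1 i), by
    have h := hp.2.const_smul r
    rwa [smul_zero] at h⟩

lemma Rankable.delete {p : ℕ → ℝ} (hp : Rankable p) (j : ℕ) : Rankable (delete j p) := by
  rw [delete_eq_comp_skip]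
  exact ⟨fun i => hp.1 _, hp.2.comp (strictMono_skip j).tendsto_atTop⟩

lemma Rankable.exists_perm {p : ℕ → ℝ} (hp : Rankable p) :
    ∃ σ : Equiv.Perm ℕ, Antitone (p ∘ σ) ∧ decreasingRearrangement p = p ∘ σ := by
  obtain ⟨σ, hσ⟩ := exists_perm_antitone hp.1 hp.2
  refine ⟨σ, hσ, ?_⟩
  rw [← decreasingRearrangement_of_antitone hσ fun i => (hp.1 _).le]
  exact decreasingRearrangement_congr fun x => (encard_lt_comp p σ x).symm

lemma Rankable.antitone {p : ℕ → ℝ} (hp : Rankable p) : Antitone (decreasingRearrangement p) := by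
  obtain ⟨σ, hσ, h⟩ := hp.exists_perm
  rwa [h]

lemma Rankable.pos {p : ℕ → ℝ} (hp : Rankable p) (i : ℕ) : 0 < decreasingRearrangement p i := by
  obtain ⟨σ, hσ, h⟩ := hp.exists_perm
  rw [h]
  exact hp.1 _

lemma Rankable.encard_lt {p : ℕ → ℝ} (hp : Rankable p) (x : ℝ) :
    {i | x < decreasingRearrangement p i}.encard = {i | x < p i}.encard := by
  obtain ⟨σ, hσ, h⟩ := hp.exists_perm
  rw [h, encard_lt_comp]

lemma Rankable.hasSum {p : ℕ → ℝ} (hp : Rankable p) {a : ℝ} (h : HasSum p a) :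
    HasSum (decreasingRearrangement p) a := by
  obtain ⟨σ, hσ, e⟩ := hp.exists_perm
  rw [e]
  exact (Equiv.hasSum_iff σ).2 h

lemma Rankable.rearrangement_smul {p : ℕ → ℝ} (hp : Rankable p) {r : ℝ} (hr : 0 < r) :
    decreasingRearrangement (r • p) = r • decreasingRearrangement p := by
  obtain ⟨σ, hσ, e⟩ := hp.exists_perm
  have h1 : Antitone (r • (p ∘ σ)) := fun a b hab => mul_le_mul_of_nonneg_left (hσ hab) hr.le
  rw [e, ← decreasingRearrangement_of_antitone h1 fun i => (mul_pos hr (hp.1 _)).le]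
  exact decreasingRearrangement_congr fun x => (encard_lt_comp (r • p) σ x).symm

lemma Rankable.rearrangement_cons {p : ℕ → ℝ} (hp : Rankable p) (a : ℝ) {r : ℝ} (hr : 0 < r) :
    decreasingRearrangement (cons a (r • decreasingRearrangement p)) =
      decreasingRearrangement (cons a (r • p)) := by
  refine decreasingRearrangement_congr fun x => ?_
  rw [encard_lt_cons, encard_lt_cons, ← hp.rearrangement_smul hr, (hp.smul hr).encard_lt]

/-- Summing over the parts in decreasing order, with the remaining parts in decreasing order, is the
same as summing over the parts as they come. -/
lemma Rankable.tsum_rearrangement {p : ℕ → ℝ} (hp : Rankable p)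
    (F : ℝ → (ℕ → ℝ) → ENNReal) :
    ∑' i, F (decreasingRearrangement p i) (Stirring.delete i (decreasingRearrangement p)) =
      ∑' i, F (p i) (decreasingRearrangement (Stirring.delete i p)) := by
  obtain ⟨σ, hσ, e⟩ := hp.exists_perm
  rw [← Equiv.tsum_eq σ fun i => F (p i) (decreasingRearrangement (Stirring.delete i p))]
  congr 1
  funext i
  rw [e]
  congr 1
  rw [← decreasingRearrangement_of_antitone (antitone_delete i hσ) fun m => by
    rw [delete_eq_comp_skip]; exact (hp.1 _).le]
  refine decreasingRearrangement_congr fun x => ?_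
  rw [encard_lt_delete, encard_lt_delete, ← σ.injective.encard_image, Set.image_sdiff σ.injective,
    Set.image_singleton]
  congr 2
  exact σ.image_preimage {i | x < p i}

/-! ### Measurability -/

section Measurability

variable {α : Type*} [MeasurableSpace α]

@[fun_prop]
lemma measurable_cons {f : α → ℝ} {g : α → ℕ → ℝ} (hf : Measurable f) (hg : Measurable g) :
    Measurable fun x => cons (f x) (g x) := by
  refine measurable_pi_lambda _ fun m => ?_
  cases m with
  | zero => exact hf
  | succ m => exact (measurable_pi_apply m).comp hg

@[fun_prop]
lemma measurable_tail : Measurable tail :=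
  measurable_pi_lambda _ fun m => measurable_pi_apply (m + 1)

@[fun_prop]
lemma measurable_delete (j : ℕ) : Measurable (delete j) := by
  refine measurable_pi_lambda _ fun m => ?_
  simp only [delete_eq_comp_skip, Function.comp]
  exact measurable_pi_apply _

@[fun_prop]
lemma measurable_smul_seq {f : α → ℝ} {g : α → ℕ → ℝ} (hf : Measurable f) (hg : Measurable g) :
    Measurable fun x => f x • g x := by
  refine measurable_pi_lambda _ fun m => ?_
  simp only [Pi.smul_apply, smul_eq_mul]
  exact hf.mul ((measurable_pi_apply m).comp hg)

@[fun_prop]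
lemma measurable_merge (j : ℕ) : Measurable fun c => merge c j := by
  refine measurable_pi_lambda _ fun m => ?_
  simp only [merge]
  split_ifs <;> fun_prop

@[fun_prop]
lemma measurable_stickBreaking : Measurable stickBreaking := by
  refine measurable_pi_lambda _ fun m => ?_
  simp only [stickBreaking]
  fun_prop

lemma measurableSet_forall {ι : Type*} [Countable ι] {P : ι → α → Prop}
    (h : ∀ i, MeasurableSet {x | P i x}) : MeasurableSet {x | ∀ i, P i x} :=
  measurableSet_setOfPred.2 (Measurable.forall fun i => measurableSet_setOfPred.1 (h i))

lemma measurableSet_exists {ι : Type*} [Countable ι] {P : ι → α → Prop}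
    (h : ∀ i, MeasurableSet {x | P i x}) : MeasurableSet {x | ∃ i, P i x} :=
  measurableSet_setOfPred.2 (Measurable.exists fun i => measurableSet_setOfPred.1 (h i))

/-- Turns a cardinality bound into countably many conditions, each involving finitely many entries.
-/
lemma encard_le_iff_forall_finset (s : Set ℕ) (k : ℕ) :
    s.encard ≤ k ↔ ∀ t : Finset ℕ, (∀ i ∈ t, i ∈ s) → t.card ≤ k := by
  constructor
  · intro h t ht
    have := (Set.encard_le_encard (s := (t : Set ℕ)) ht).trans h
    rwa [Set.encard_coe_eq_coe_finsetCard, Nat.cast_le] at this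
  · intro h
    by_contra! hk
    obtain ⟨t, ht, hc⟩ := Set.exists_subset_encard_eq (Order.add_one_le_of_lt hk)
    have hfin : t.Finite := Set.finite_of_encard_eq_coe (k := k + 1) (by simpa using hc)
    have h1 := h hfin.toFinset fun i hi => ht (by simpa using hi)
    rw [hfin.encard_eq_coe_toFinset_card] at hc
    have h2 : hfin.toFinset.card = k + 1 := by exact_mod_cast hc
    omega

lemma measurableSet_encard_le (x : ℝ) (k : ℕ) :
    MeasurableSet {p : ℕ → ℝ | {i | x < p i}.encard ≤ k} := by
  simp only [encard_le_iff_forall_finset]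
  refine measurableSet_forall fun t => ?_
  by_cases h : t.card ≤ k
  · simp [h]
  · simp only [h, imp_false]
    refine MeasurableSet.compl (measurableSet_forall fun i => ?_)
    by_cases hi : i ∈ t
    · simpa [hi] using measurableSet_lt measurable_const (measurable_pi_apply i)
    · simp [hi]

@[fun_prop]
lemma measurable_decreasingRearrangement : Measurable decreasingRearrangement := by
  refine measurable_pi_lambda _ fun k => measurable_of_Iio fun y => ?_
  have hbdd : ∀ p : ℕ → ℝ, BddBelow {x : ℝ | 0 ≤ x ∧ {i : ℕ | x < p i}.encard ≤ k} :=
    fun p => ⟨0, fun x hx => hx.1⟩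
  have hmono : ∀ (p : ℕ → ℝ) {x z : ℝ}, x ≤ z → {i : ℕ | x < p i}.encard ≤ k →
      {i : ℕ | z < p i}.encard ≤ k := fun p x z hxz h =>
    (Set.encard_le_encard fun i (hi : z < p i) => hxz.trans_lt hi).trans h
  -- Admissible levels form an up-set, so rational levels detect an infimum below `y`. The second
  -- set covers sequences with no admissible level, where the infimum takes the default value `0`;
  -- testing natural levels suffices for this.
  have : (fun p => decreasingRearrangement p k) ⁻¹' Set.Iio y =
      {p | ∃ r : ℚ, (0 ≤ (r : ℝ) ∧ (r : ℝ) < y) ∧ {i | (r : ℝ) < p i}.encard ≤ k} ∪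
      {p | 0 < y ∧ ∀ n : ℕ, ¬ {i | (n : ℝ) < p i}.encard ≤ k} := by
    ext p
    simp only [Set.mem_preimage, Set.mem_Iio, Set.mem_union, Set.mem_ofPred_eq]
    by_cases hne : {x : ℝ | 0 ≤ x ∧ {i : ℕ | x < p i}.encard ≤ k}.Nonempty
    · have hno : ¬ ∀ n : ℕ, ¬ {i | (n : ℝ) < p i}.encard ≤ k := by
        obtain ⟨x, _, hx⟩ := hne
        obtain ⟨n, hn⟩ := exists_nat_ge x
        exact fun h => h n (hmono p hn hx)
      simp only [hno, and_false, or_false]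
      constructor
      · intro h
        obtain ⟨x, ⟨hx0, hx⟩, hxy⟩ := (csInf_lt_iff (hbdd p) hne).1 h
        obtain ⟨r, hr1, hr2⟩ := exists_rat_btwn hxy
        exact ⟨r, ⟨hx0.trans hr1.le, hr2⟩, hmono p hr1.le hx⟩
      · rintro ⟨r, ⟨hr0, hry⟩, hr⟩
        exact (csInf_le (hbdd p) ⟨hr0, hr⟩).trans_lt hry
    · have hz : decreasingRearrangement p k = 0 := by
        rw [decreasingRearrangement, Set.not_nonempty_iff_eq_empty.1 hne, Real.sInf_empty]
      rw [hz]
      constructor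
      · exact fun h => Or.inr ⟨h, fun n hn => hne ⟨n, n.cast_nonneg, hn⟩⟩
      · rintro (⟨r, ⟨hr0, hry⟩, hr⟩ | h)
        · exact hr0.trans_lt hry
        · exact h.1
  rw [this]
  refine MeasurableSet.union (measurableSet_exists fun r => ?_) ?_
  · exact (MeasurableSet.const _).inter (measurableSet_encard_le _ _)
  · exact (MeasurableSet.const _).inter
      (measurableSet_forall fun n => (measurableSet_encard_le _ _).compl)

lemma measurable_sInf_nat {P : ℕ → α → Prop} (hP : ∀ i, MeasurableSet {x | P i x}) :
    Measurable fun x => sInf {i | P i x} := by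
  -- The second alternative makes the search stop at `0` when nothing satisfies `P`, in agreement
  -- with `sInf ∅ = 0`.
  have hex : ∀ x, ∃ i, P i x ∨ ∀ m, ¬ P m x := by
    intro x
    by_cases h : ∃ i, P i x
    · exact h.imp fun i hi => Or.inl hi
    · exact ⟨0, Or.inr (not_exists.1 h)⟩
  classical
  have h := measurable_find hex fun i =>
    (hP i).union (measurableSet_forall fun m => (hP m).compl)
  convert h using 2 with x
  by_cases hx : ∃ i, P i x
  · have hx' : ¬ ∀ m, ¬ P m x := by simpa using hx
    exact ((Nat.find_eq_iff _).2 ⟨Or.inl (Nat.sInf_mem hx), fun n hn h =>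
      Nat.notMem_of_lt_sInf hn (h.resolve_right hx')⟩).symm
  · have hx' : ∀ m, ¬ P m x := not_exists.1 hx
    have : {i | P i x} = ∅ := Set.eq_empty_of_forall_notMem hx'
    rw [this, Nat.sInf_empty]
    exact ((Nat.find_eq_zero (hex x)).2 (Or.inr hx')).symm

lemma measurable_apply_index {β : Type*} [MeasurableSpace β] {f : ℕ → α → β} {N : α → ℕ}
    (hf : ∀ n, Measurable (f n)) (hN : Measurable N) : Measurable fun x => f (N x) x :=
  (measurable_from_prod_countable_right (f := fun y : ℕ × α => f y.1 y.2) hf).comp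
    (hN.prodMk measurable_id)

lemma measurable_partialSum (n : ℕ) :
    Measurable fun x : (ℕ → ℝ) × ℝ => ∑ m ∈ Finset.range n, x.1 m := by
  fun_prop

lemma measurable_sizeBiasedIndex :
    Measurable fun x : (ℕ → ℝ) × ℝ => sizeBiasedIndex x.1 x.2 :=
  measurable_sInf_nat fun i => measurableSet_lt measurable_snd (measurable_partialSum (i + 1))

lemma measurable_activateSizeBiased :
    Measurable fun x : (ℕ → ℝ) × ℝ => activateSizeBiased x.1 x.2 :=
  measurable_apply_index (f := fun i (x : (ℕ → ℝ) × ℝ) => cons (x.1 i) (delete i x.1))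
    (fun i => by fun_prop) measurable_sizeBiasedIndex

lemma measurable_split : Measurable fun x : (ℕ → ℝ) × ℝ => split x.1 x.2 := by
  have : Measurable fun x : (ℕ → ℝ) × ℝ =>
      cons x.2 (decreasingRearrangement (cons (x.1 0 - x.2) (tail x.1))) := by fun_prop
  exact this

lemma measurable_splitMerge : Measurable fun x : (ℕ → ℝ) × ℝ => splitMerge x.1 x.2 := by
  have hle : ∀ j, MeasurableSet
      {x : (ℕ → ℝ) × ℝ | x.2 ≤ ∑ m ∈ Finset.range (j + 1), x.1 m} := fun j =>
    measurableSet_le measurable_snd (measurable_partialSum (j + 1))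
  refine Measurable.ite (measurableSet_le (by fun_prop) (by fun_prop)) measurable_split ?_
  refine Measurable.ite (measurableSet_exists hle) ?_ measurable_fst
  exact measurable_apply_index (f := fun j (x : (ℕ → ℝ) × ℝ) => merge x.1 j)
    (fun j => (measurable_merge j).comp measurable_fst) (measurable_sInf_nat hle)

end Measurability

/-! ### The stick-breaking law -/

instance : IsProbabilityMeasure uniform01 := ⟨by simp [uniform01]⟩

instance : IsProbabilityMeasure gemOne :=
  Measure.isProbabilityMeasure_map measurable_stickBreaking.aemeasurable

instance : IsProbabilityMeasure poissonDirichletOne :=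
  Measure.isProbabilityMeasure_map measurable_decreasingRearrangement.aemeasurable

instance : IsProbabilityMeasure stirringLaw :=
  Measure.isProbabilityMeasure_map measurable_activateSizeBiased.aemeasurable

lemma map_cons_infinitePi (ν : Measure ℝ) [IsProbabilityMeasure ν] :
    (ν.prod (Measure.infinitePi fun _ : ℕ => ν)).map (fun x => cons x.1 x.2) =
      Measure.infinitePi fun _ : ℕ => ν := by
  refine Measure.eq_infinitePi _ fun s t ht => ?_
  rw [Measure.map_apply (by fun_prop) (MeasurableSet.pi s.countable_toSet fun i _ => ht i)]
  classical
  -- Padding with `Set.univ` turns the cylinder over `s` into one over an initial segment, from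
  -- which coordinate `0` splits off.
  let t' : ℕ → Set ℝ := fun i => if i ∈ s then t i else Set.univ
  have ht' : ∀ i, MeasurableSet (t' i) := fun i => by
    simp only [t']; split_ifs
    · exact ht i
    · exact MeasurableSet.univ
  let n := s.sup id + 1
  have hn : ∀ i ∈ s, i < n + 1 := fun i hi => by
    have := Finset.le_sup (f := id) hi
    simp only [id, n] at this ⊢; omega
  have hset : (fun x : ℝ × (ℕ → ℝ) => cons x.1 x.2) ⁻¹' ((s : Set ℕ).pi t) =
      t' 0 ×ˢ ((Finset.range n : Set ℕ).pi fun i => t' (i + 1)) := by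
    ext ⟨a, w⟩
    simp only [Set.mem_preimage, Set.mem_pi, Finset.mem_coe, Set.mem_prod, Finset.mem_range, t']
    constructor
    · intro h
      refine ⟨?_, fun i _ => ?_⟩
      · split_ifs with h0
        · exact h 0 h0
        · trivial
      · split_ifs with h0
        · exact h _ h0
        · trivial
    · rintro ⟨h0, h1⟩ i hi
      rcases i with _ | i
      · simpa [hi] using h0
      · simpa [hi] using h1 i (by have := hn _ hi; omega)
  rw [hset, Measure.prod_prod, Measure.infinitePi_pi _ fun i _ => ht' (i + 1), mul_comm,
    ← Finset.prod_range_succ' (fun i => ν (t' i))]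
  have hsub : s ⊆ Finset.range (n + 1) := fun i hi => Finset.mem_range.2 (hn i hi)
  rw [← Finset.prod_subset hsub fun i _ hi => by simp [t', hi]]
  exact Finset.prod_congr rfl fun i hi => by simp [t', hi]

lemma stickBreaking_cons (a : ℝ) (w : ℕ → ℝ) :
    stickBreaking (cons a w) = cons a ((1 - a) • stickBreaking w) := by
  funext m
  rcases m with _ | m
  · simp [stickBreaking]
  · simp only [stickBreaking, cons_succ, Pi.smul_apply, smul_eq_mul, Finset.prod_range_succ',
      cons_zero]
    ring

/-- The first part of a stick breaking sequence is uniform, and the rest is an independent stick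
breaking sequence on the remaining mass. -/
lemma lintegral_gemOne {F : (ℕ → ℝ) → ℝ≥0∞} (hF : Measurable F) :
    ∫⁻ g, F g ∂gemOne = ∫⁻ w, ∫⁻ g, F (cons w ((1 - w) • g)) ∂gemOne ∂uniform01 := by
  rw [gemOne, lintegral_map hF measurable_stickBreaking, ← map_cons_infinitePi uniform01,
    lintegral_map (by fun_prop) (by fun_prop), lintegral_prod _ (by fun_prop),
    map_cons_infinitePi uniform01]
  congr 1 with w
  rw [lintegral_map (by fun_prop) measurable_stickBreaking]
  simp only [stickBreaking_cons]

lemma ae_uniform01 : ∀ᵐ w ∂uniform01, w ∈ Set.Ioo (0 : ℝ) 1 := by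
  rw [uniform01, ← restrict_Ioo_eq_restrict_Icc]
  exact ae_restrict_mem measurableSet_Ioo

lemma lintegral_one_sub_uniform01 : ∫⁻ w, ENNReal.ofReal (1 - w) ∂uniform01 = 2⁻¹ := by
  rw [uniform01, ← ofReal_integral_eq_lintegral_ofReal]
  · rw [integral_Icc_eq_integral_Ioc, ← intervalIntegral.integral_of_le zero_le_one]
    simp only [intervalIntegral.integral_comp_sub_left fun x : ℝ => x, integral_id]
    norm_num [ENNReal.ofReal_div_of_pos]
  · exact (by fun_prop : Continuous fun w : ℝ => 1 - w).integrableOn_Icc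
  · filter_upwards [ae_restrict_mem measurableSet_Icc] with w hw
    simpa using hw.2

lemma lintegral_prod_one_sub (n : ℕ) :
    ∫⁻ w, ∏ i ∈ Finset.range n, ENNReal.ofReal (1 - w i)
      ∂(Measure.infinitePi fun _ : ℕ => uniform01) = 2⁻¹ ^ n := by
  induction n with
  | zero => simp
  | succ n ih =>
    rw [← map_cons_infinitePi uniform01, lintegral_map (by fun_prop) (by fun_prop),
      lintegral_prod _ (by fun_prop)]
    simp only [Finset.prod_range_succ', cons_zero, cons_succ]
    have : ∀ a : ℝ, ∫⁻ w, (∏ i ∈ Finset.range n, ENNReal.ofReal (1 - w i)) * ENNReal.ofReal (1 - a)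
        ∂(Measure.infinitePi fun _ : ℕ => uniform01) = 2⁻¹ ^ n * ENNReal.ofReal (1 - a) := by
      intro a
      rw [lintegral_mul_const _ (by fun_prop), ih]
    simp only [this]
    rw [lintegral_const_mul _ (by fun_prop), lintegral_one_sub_uniform01, pow_succ]

lemma sum_stickBreaking (w : ℕ → ℝ) (n : ℕ) :
    ∑ k ∈ Finset.range n, stickBreaking w k = 1 - ∏ i ∈ Finset.range n, (1 - w i) := by
  induction n with
  | zero => simp
  | succ n ih => rw [Finset.sum_range_succ, ih, Finset.prod_range_succ, stickBreaking]; ring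

/-- The sequences of positive numbers with sum `1`. -/
def PositiveUnitSum (p : ℕ → ℝ) : Prop := (∀ i, 0 < p i) ∧ HasSum p 1

lemma PositiveUnitSum.rankable {p : ℕ → ℝ} (hp : PositiveUnitSum p) : Rankable p :=
  ⟨hp.1, by simpa [Nat.cofinite_eq_atTop] using hp.2.summable.tendsto_cofinite_zero⟩

lemma positiveUnitSum_iff {p : ℕ → ℝ} :
    PositiveUnitSum p ↔ (∀ i, 0 < p i) ∧ ∑' i, ENNReal.ofReal (p i) = 1 := by
  refine and_congr_right fun h0 => ⟨fun h => ?_, fun h => ?_⟩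
  · rw [← ENNReal.ofReal_tsum_of_nonneg (fun i => (h0 i).le) h.summable, h.tsum_eq,
      ENNReal.ofReal_one]
  · have hs : Summable p := by
      have := ENNReal.summable_toReal (h.trans_ne ENNReal.one_ne_top)
      simpa only [ENNReal.toReal_ofReal (h0 _).le] using this
    rw [← ENNReal.ofReal_tsum_of_nonneg (fun i => (h0 i).le) hs, ENNReal.ofReal_eq_one] at h
    exact h ▸ hs.hasSum

lemma measurableSet_positiveUnitSum : MeasurableSet {p | PositiveUnitSum p} := by
  simp only [positiveUnitSum_iff]
  refine MeasurableSet.inter (measurableSet_forall fun i => ?_) ?_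
  · exact measurableSet_lt measurable_const (measurable_pi_apply i)
  · exact measurableSet_eq_fun (by fun_prop) measurable_const

/-- The mass left after `n` sticks has mean `2⁻¹ ^ n`. These means are summable, so the sum of the
leftover masses is almost surely finite and its terms tend to `0`. -/
lemma ae_gemOne : ∀ᵐ g ∂gemOne, PositiveUnitSum g := by
  rw [gemOne, ae_map_iff measurable_stickBreaking.aemeasurable measurableSet_positiveUnitSum]
  have h1 : ∀ᵐ w ∂(Measure.infinitePi fun _ : ℕ => uniform01), ∀ i, w i ∈ Set.Ioo (0 : ℝ) 1 := by
    refine ae_all_iff.2 fun i => ?_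
    exact (measurePreserving_eval_infinitePi (fun _ : ℕ => uniform01) i).quasiMeasurePreserving.ae
      ae_uniform01
  have h2 : ∫⁻ w, ∑' n, ∏ i ∈ Finset.range n, ENNReal.ofReal (1 - w i)
      ∂(Measure.infinitePi fun _ : ℕ => uniform01) ≠ ∞ := by
    rw [lintegral_tsum fun n => Measurable.aemeasurable (by fun_prop)]
    simp only [lintegral_prod_one_sub, ENNReal.tsum_geometric]
    norm_num
  filter_upwards [h1, ae_lt_top (by fun_prop) h2] with w hw hlt
  have hnn : ∀ i, 0 < 1 - w i := fun i => sub_pos.2 (hw i).2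
  have hpos : ∀ k, 0 < stickBreaking w k := fun k =>
    mul_pos (Finset.prod_pos fun i _ => hnn i) (hw k).1
  refine ⟨hpos, ?_⟩
  rw [hasSum_iff_tendsto_nat_of_nonneg fun i => (hpos i).le]
  simp only [sum_stickBreaking]
  have h3 := ENNReal.tendsto_atTop_zero_of_tsum_ne_top hlt.ne
  have h4 := (ENNReal.tendsto_toReal ENNReal.zero_ne_top).comp h3
  have h5 : Tendsto (fun n => ∏ i ∈ Finset.range n, (1 - w i)) atTop (𝓝 0) := by
    refine h4.congr fun n => ?_
    simp only [Function.comp, ENNReal.toReal_prod]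
    exact Finset.prod_congr rfl fun i _ => ENNReal.toReal_ofReal (hnn i).le
  simpa using h5.const_sub 1

/-! ### Changes of variables on the triangle -/

lemma lintegral_uniform01 (f : ℝ → ℝ≥0∞) :
    ∫⁻ x, f x ∂uniform01 = ∫⁻ x, (Set.Icc 0 1).indicator f x := by
  rw [uniform01, lintegral_indicator measurableSet_Icc]

lemma lintegral_uniform01_mul_left {f : ℝ → ℝ≥0∞} (hf : Measurable f) {r : ℝ} (hr : 0 ≤ r) :
    ENNReal.ofReal r * ∫⁻ b, f (r * b) ∂uniform01 = ∫⁻ x, (Set.Icc 0 r).indicator f x := by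
  rcases hr.eq_or_lt with rfl | hr
  · rw [lintegral_indicator measurableSet_Icc]
    simp
  · have h1 : ∀ b, (Set.Icc (0 : ℝ) 1).indicator (fun b => f (r * b)) b =
        (Set.Icc 0 r).indicator f (r * b) := by
      intro b
      have : b ∈ Set.Icc (0 : ℝ) 1 ↔ r * b ∈ Set.Icc 0 r := by
        rw [Set.mem_Icc, Set.mem_Icc, mul_nonneg_iff_of_pos_left hr, mul_le_iff_le_one_right hr]
      by_cases hb : b ∈ Set.Icc (0 : ℝ) 1
      · rw [Set.indicator_of_mem hb, Set.indicator_of_mem (this.1 hb)]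
      · rw [Set.indicator_of_notMem hb, Set.indicator_of_notMem (mt this.2 hb)]
    rw [lintegral_uniform01]
    simp only [h1]
    rw [← lintegral_map (f := (Set.Icc 0 r).indicator f) (g := fun b => r * b)
      (hf.indicator measurableSet_Icc) (by fun_prop), Real.map_volume_mul_left hr.ne',
      lintegral_smul_measure, abs_of_pos (inv_pos.2 hr), smul_eq_mul, ← mul_assoc,
      ← ENNReal.ofReal_mul hr.le, mul_inv_cancel₀ hr.ne', ENNReal.ofReal_one, one_mul]

lemma ae_uniform01_Icc : ∀ᵐ w ∂uniform01, w ∈ Set.Icc (0 : ℝ) 1 :=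
  ae_uniform01.mono fun _ h => Set.Ioo_subset_Icc_self h

/-- Both sides integrate `K` over the triangle `{(x, y) | 0 ≤ x, 0 ≤ y, x + y ≤ 1}`. -/
lemma lintegral_triangle_swap {K : ℝ → ℝ → ℝ≥0∞} (hK : Measurable (Function.uncurry K)) :
    ∫⁻ w, ENNReal.ofReal (1 - w) * ∫⁻ b, K ((1 - w) * b) w ∂uniform01 ∂uniform01 =
      ∫⁻ y, ENNReal.ofReal (1 - y) * ∫⁻ b, K y ((1 - y) * b) ∂uniform01 ∂uniform01 := by
  have h1 : ∀ᵐ w ∂uniform01, ENNReal.ofReal (1 - w) * ∫⁻ b, K ((1 - w) * b) w ∂uniform01 =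
      ∫⁻ x, (Set.Icc 0 (1 - w)).indicator (fun x => K x w) x := by
    filter_upwards [ae_uniform01_Icc] with w hw
    exact lintegral_uniform01_mul_left (f := fun x => K x w) (by fun_prop) (sub_nonneg.2 hw.2)
  have h2 : ∀ᵐ y ∂uniform01, ENNReal.ofReal (1 - y) * ∫⁻ b, K y ((1 - y) * b) ∂uniform01 =
      ∫⁻ x, (Set.Icc 0 (1 - y)).indicator (fun x => K y x) x := by
    filter_upwards [ae_uniform01_Icc] with y hy
    exact lintegral_uniform01_mul_left (f := fun x => K y x) (by fun_prop) (sub_nonneg.2 hy.2)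
  let T : Set (ℝ × ℝ) := {z | 0 ≤ z.1} ∩ ({z | 0 ≤ z.2} ∩ {z | z.1 + z.2 ≤ 1})
  have hmem : ∀ x y, (x, y) ∈ T ↔ 0 ≤ x ∧ 0 ≤ y ∧ x + y ≤ 1 := fun x y => Iff.rfl
  have hT : MeasurableSet T := by
    refine (measurableSet_le ?_ ?_).inter ((measurableSet_le ?_ ?_).inter
      (measurableSet_le ?_ ?_)) <;> fun_prop
  have hTK : Measurable (T.indicator (Function.uncurry K)) := hK.indicator hT
  rw [lintegral_congr_ae h1, lintegral_congr_ae h2, lintegral_uniform01, lintegral_uniform01]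
  have h3 : ∀ w, (Set.Icc 0 1).indicator
      (fun w => ∫⁻ x, (Set.Icc 0 (1 - w)).indicator (fun x => K x w) x) w =
      ∫⁻ x, T.indicator (Function.uncurry K) (x, w) := by
    intro w
    by_cases hw : w ∈ Set.Icc (0 : ℝ) 1
    · rw [Set.indicator_of_mem hw]
      congr 1 with x
      by_cases hx : x ∈ Set.Icc 0 (1 - w)
      · rw [Set.indicator_of_mem hx, Set.indicator_of_mem]
        · rfl
        · exact (hmem _ _).2 ⟨hx.1, hw.1, by linarith [hx.2]⟩
      · rw [Set.indicator_of_notMem hx, Set.indicator_of_notMem]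
        exact fun h => hx ⟨h.1, by linarith [((hmem _ _).1 h).2.2]⟩
    · rw [Set.indicator_of_notMem hw, eq_comm, lintegral_eq_zero_of_ae_eq_zero]
      refine Eventually.of_forall fun x => Set.indicator_of_notMem (fun h => hw ?_) _
      rw [hmem] at h
      exact ⟨h.2.1, by linarith [h.1, h.2.2]⟩
  have h4 : ∀ y, (Set.Icc 0 1).indicator
      (fun y => ∫⁻ x, (Set.Icc 0 (1 - y)).indicator (fun x => K y x) x) y =
      ∫⁻ x, T.indicator (Function.uncurry K) (y, x) := by
    intro w
    by_cases hw : w ∈ Set.Icc (0 : ℝ) 1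
    · rw [Set.indicator_of_mem hw]
      congr 1 with x
      by_cases hx : x ∈ Set.Icc 0 (1 - w)
      · rw [Set.indicator_of_mem hx, Set.indicator_of_mem]
        · rfl
        · exact (hmem _ _).2 ⟨hw.1, hx.1, by linarith [hx.2]⟩
      · rw [Set.indicator_of_notMem hx, Set.indicator_of_notMem]
        exact fun h => hx ⟨h.2.1, by linarith [((hmem _ _).1 h).2.2]⟩
    · rw [Set.indicator_of_notMem hw, eq_comm, lintegral_eq_zero_of_ae_eq_zero]
      refine Eventually.of_forall fun x => Set.indicator_of_notMem (fun h => hw ?_) _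
      rw [hmem] at h
      exact ⟨h.1, by linarith [h.2.1, h.2.2]⟩
  simp only [h3, h4]
  exact lintegral_lintegral_swap (f := fun w x => T.indicator (Function.uncurry K) (x, w))
    (Measurable.aemeasurable (by fun_prop))

/-- After exchanging the integrals, translate by `u`: the fragment `w - u` ranges over `[0, 1 - u]`.
-/
lemma lintegral_triangle_sub {K : ℝ → ℝ → ℝ≥0∞} (hK : Measurable (Function.uncurry K)) :
    ∫⁻ w, ∫⁻ u, (if u ≤ w then K u (w - u) else 0) ∂uniform01 ∂uniform01 =
      ∫⁻ y, ENNReal.ofReal (1 - y) * ∫⁻ b, K y ((1 - y) * b) ∂uniform01 ∂uniform01 := by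
  have hm : Measurable fun z : ℝ × ℝ => if z.2 ≤ z.1 then K z.2 (z.1 - z.2) else 0 :=
    Measurable.ite (measurableSet_le measurable_snd measurable_fst) (by fun_prop) measurable_const
  rw [lintegral_lintegral_swap (f := fun w u => if u ≤ w then K u (w - u) else 0) hm.aemeasurable]
  refine lintegral_congr_ae ?_
  filter_upwards [ae_uniform01_Icc] with u hu
  rw [lintegral_uniform01_mul_left (f := fun x => K u x) (by fun_prop) (sub_nonneg.2 hu.2),
    lintegral_uniform01,
    ← lintegral_sub_right_eq_self ((Set.Icc 0 (1 - u)).indicator fun x => K u x) u]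
  congr 1 with w
  by_cases hw : w ∈ Set.Icc u 1
  · rw [Set.indicator_of_mem, Set.indicator_of_mem, if_pos hw.1]
    · exact ⟨sub_nonneg.2 hw.1, sub_le_sub_right hw.2 u⟩
    · exact ⟨hu.1.trans hw.1, hw.2⟩
  · rw [Set.indicator_of_notMem (s := Set.Icc 0 (1 - u))]
    · rw [Set.indicator_apply_eq_zero]
      exact fun h => if_neg fun h' => hw ⟨h', h.2⟩
    · exact fun h => hw ⟨sub_nonneg.1 h.1, by linarith [h.2]⟩

/-- Substituting `x = w + (1 - w) * b` makes `x` range over `[w, 1]`; the factor `x` is the length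
of the set of `w` in `[0, x]`. -/
lemma lintegral_triangle_add {L : ℝ → ℝ≥0∞} (hL : Measurable L) :
    ∫⁻ w, ENNReal.ofReal (1 - w) * ∫⁻ b, L (w + (1 - w) * b) ∂uniform01 ∂uniform01 =
      ∫⁻ x, ENNReal.ofReal x * L x ∂uniform01 := by
  have h1 : ∀ᵐ w ∂uniform01, ENNReal.ofReal (1 - w) * ∫⁻ b, L (w + (1 - w) * b) ∂uniform01 =
      ∫⁻ x, (if w ≤ x then L x else 0) ∂uniform01 := by
    filter_upwards [ae_uniform01_Icc] with w hw
    rw [lintegral_uniform01_mul_left (f := fun x => L (w + x)) (by fun_prop) (sub_nonneg.2 hw.2),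
      lintegral_uniform01,
      ← lintegral_add_left_eq_self ((Set.Icc 0 1).indicator fun x => if w ≤ x then L x else 0) w]
    congr 1 with x
    by_cases hx : x ∈ Set.Icc 0 (1 - w)
    · rw [Set.indicator_of_mem hx, Set.indicator_of_mem, if_pos (by linarith [hx.1])]
      exact ⟨by linarith [hw.1, hx.1], by linarith [hx.2]⟩
    · rw [Set.indicator_of_notMem hx, eq_comm, Set.indicator_apply_eq_zero]
      exact fun h => if_neg fun h' => hx ⟨by linarith, by linarith [h.2]⟩
  have hm : Measurable fun z : ℝ × ℝ => if z.1 ≤ z.2 then L z.2 else 0 :=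
    Measurable.ite (measurableSet_le measurable_fst measurable_snd) (by fun_prop) measurable_const
  rw [lintegral_congr_ae h1,
    lintegral_lintegral_swap (f := fun w x => if w ≤ x then L x else 0) hm.aemeasurable]
  refine lintegral_congr_ae ?_
  filter_upwards [ae_uniform01_Icc] with x hx
  have : ∀ w, (if w ≤ x then L x else 0) = (Set.Iic x).indicator (fun _ => L x) w := fun w => by
    simp only [Set.indicator_apply, Set.mem_Iic]
  simp only [this]
  rw [lintegral_indicator_const measurableSet_Iic, uniform01,
    Measure.restrict_apply measurableSet_Iic, mul_comm]
  have : Set.Iic x ∩ Set.Icc 0 1 = Set.Icc 0 x := by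
    ext w
    simp only [Set.mem_inter_iff, Set.mem_Iic, Set.mem_Icc]
    constructor
    · exact fun h => ⟨h.2.1, h.1⟩
    · exact fun h => ⟨h.2, h.1, h.2.trans hx.2⟩
  rw [this, Real.volume_Icc, sub_zero]

/-! ### Selecting a part by a uniform point -/

section Index

variable {p : ℕ → ℝ}

lemma monotone_partialSum (hp : ∀ i, 0 ≤ p i) :
    Monotone fun n => ∑ k ∈ Finset.range n, p k :=
  monotone_nat_of_le_succ fun n => by
    rw [Finset.sum_range_succ]
    exact le_add_of_nonneg_right (hp n)

lemma PositiveUnitSum.exists_lt_partialSum (hp : PositiveUnitSum p) {v : ℝ} (hv : v < 1) :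
    ∃ i, v < ∑ k ∈ Finset.range (i + 1), p k := by
  have h := (tendsto_add_atTop_nat 1).eventually
    (hp.2.tendsto_sum_nat.eventually (lt_mem_nhds hv))
  exact h.exists

lemma PositiveUnitSum.partialSum_le (hp : PositiveUnitSum p) (n : ℕ) :
    ∑ k ∈ Finset.range n, p k ≤ 1 :=
  sum_le_hasSum _ (fun i _ => (hp.1 i).le) hp.2

lemma PositiveUnitSum.sizeBiasedIndex_eq_iff (hp : PositiveUnitSum p) {v : ℝ}
    (hv : v ∈ Set.Ioo (0 : ℝ) 1) (i : ℕ) :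
    sizeBiasedIndex p v = i ↔
      v ∈ Set.Ico (∑ k ∈ Finset.range i, p k) (∑ k ∈ Finset.range (i + 1), p k) := by
  have hmono := monotone_partialSum fun i => (hp.1 i).le
  have hmem : v < ∑ k ∈ Finset.range (sizeBiasedIndex p v + 1), p k :=
    Nat.sInf_mem (s := {i | v < ∑ k ∈ Finset.range (i + 1), p k}) (hp.exists_lt_partialSum hv.2)
  have hlow : ∑ k ∈ Finset.range (sizeBiasedIndex p v), p k ≤ v := by
    rcases h : sizeBiasedIndex p v with _ | m
    · simpa using hv.1.le
    · by_contra! hlt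
      have : sizeBiasedIndex p v ≤ m := Nat.sInf_le hlt
      omega
  constructor
  · rintro rfl
    exact ⟨hlow, hmem⟩
  · rintro ⟨h1, h2⟩
    refine le_antisymm (Nat.sInf_le h2) ?_
    by_contra! hlt
    exact absurd (hmem.trans_le (hmono (Nat.succ_le_of_lt hlt))) (not_lt.2 h1)

lemma PositiveUnitSum.lintegral_sizeBiasedIndex (hp : PositiveUnitSum p) (f : ℕ → ℝ≥0∞) :
    ∫⁻ v, f (sizeBiasedIndex p v) ∂uniform01 = ∑' i, ENNReal.ofReal (p i) * f i := by
  have hm : Measurable fun v => sizeBiasedIndex p v :=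
    measurable_sizeBiasedIndex.comp (by fun_prop : Measurable fun v : ℝ => (p, v))
  rw [← lintegral_map (f := f) (g := fun v => sizeBiasedIndex p v) measurable_from_top hm,
    lintegral_countable']
  congr 1 with i
  rw [Measure.map_apply hm (measurableSet_singleton i), mul_comm]
  congr 1
  have h1 : (fun v => sizeBiasedIndex p v) ⁻¹' {i} =ᵐ[uniform01]
      Set.Ico (∑ k ∈ Finset.range i, p k) (∑ k ∈ Finset.range (i + 1), p k) := by
    filter_upwards [ae_uniform01] with v hv
    exact propext (hp.sizeBiasedIndex_eq_iff hv i)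
  rw [measure_congr h1, uniform01, Measure.restrict_apply measurableSet_Ico,
    Set.inter_eq_self_of_subset_left, Real.volume_Ico, Finset.sum_range_succ, add_sub_cancel_left]
  intro v hv
  exact ⟨(Finset.sum_nonneg fun k _ => (hp.1 k).le).trans hv.1, hv.2.le.trans (hp.partialSum_le _)⟩

/-- The two indices differ only in which end of each interval is closed, which matters at the
countably many partial sums alone. -/
lemma ae_mergeIndex_eq (p : ℕ → ℝ) :
    ∀ᵐ u ∂uniform01, mergeIndex p u = sizeBiasedIndex p u := by
  have : ∀ᵐ u : ℝ, u ∉ Set.range fun n => ∑ k ∈ Finset.range n, p k :=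
    (Set.countable_range _).ae_notMem _
  filter_upwards [ae_restrict_of_ae this] with u hu
  rw [mergeIndex, sizeBiasedIndex]
  congr 1
  ext j
  exact ⟨fun h => lt_of_le_of_ne h fun e => hu ⟨_, e.symm⟩, fun h => Set.mem_ofPred.2 (le_of_lt h)⟩

lemma merge_succ (c : ℕ → ℝ) (j : ℕ) :
    merge c (j + 1) = cons (c 0 + c (j + 1)) (delete j (tail c)) := by
  funext m
  rcases m with _ | m
  · simp [merge]
  · simp [merge, delete, tail]

lemma PositiveUnitSum.lintegral_splitMerge (hp : PositiveUnitSum p) {F : (ℕ → ℝ) → ℝ≥0∞}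
    (hF : Measurable F) :
    ∫⁻ u, F (splitMerge p u) ∂uniform01 =
      ∫⁻ u, (if u ≤ p 0 then F (split p u) else 0) ∂uniform01 +
        ∑' j, ENNReal.ofReal (p (j + 1)) * F (cons (p 0 + p (j + 1)) (delete j (tail p))) := by
  -- Index `0` means that `u` falls in the active part, which is the split case; setting `f 0 = 0`
  -- leaves only merges in the sum.
  let f : ℕ → ℝ≥0∞ := fun j => if j = 0 then 0 else F (merge p j)
  have h1 : ∀ᵐ u ∂uniform01, F (splitMerge p u) =
      (if u ≤ p 0 then F (split p u) else 0) + f (sizeBiasedIndex p u) := by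
    filter_upwards [ae_uniform01, ae_mergeIndex_eq p] with u hu hm
    rw [← hm, splitMerge]
    by_cases h : u ≤ p 0
    · have h0 : mergeIndex p u = 0 := by
        rw [mergeIndex, Nat.sInf_eq_zero]
        exact Or.inl (by simpa using h)
      simp [h, f, h0]
    · have hex : ∃ j, u ≤ ∑ m ∈ Finset.range (j + 1), p m :=
        (hp.exists_lt_partialSum hu.2).imp fun _ h => h.le
      have h0 : mergeIndex p u ≠ 0 := by
        intro h0
        have := Nat.sInf_mem (s := {j | u ≤ ∑ m ∈ Finset.range (j + 1), p m}) hex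
        rw [mergeIndex] at h0
        rw [h0] at this
        exact h (by simpa using this)
      rw [if_neg h, if_pos hex, if_neg h, zero_add]
      simp only [f, if_neg h0]
  have hsplit : Measurable fun u => if u ≤ p 0 then F (split p u) else 0 :=
    Measurable.ite measurableSet_Iic
      (hF.comp (measurable_split.comp (by fun_prop : Measurable fun v : ℝ => (p, v))))
      measurable_const
  rw [lintegral_congr_ae h1, lintegral_add_left hsplit, hp.lintegral_sizeBiasedIndex,
    tsum_eq_zero_add' ENNReal.summable]
  simp [f, merge_succ]

end Index

/-! ### The law of a size-biased part and of the remaining parts -/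

lemma hasSum_cons (a : ℝ) {s : ℕ → ℝ} {x : ℝ} (h : HasSum s x) : HasSum (cons a s) (a + x) := by
  have := (hasSum_nat_add_iff (f := cons a s) 1).1 h
  simpa [add_comm] using this

lemma PositiveUnitSum.rearrangement {p : ℕ → ℝ} (hp : PositiveUnitSum p) :
    PositiveUnitSum (decreasingRearrangement p) :=
  ⟨hp.rankable.pos, hp.rankable.hasSum hp.2⟩

lemma PositiveUnitSum.cons {p : ℕ → ℝ} (hp : PositiveUnitSum p) {w : ℝ}
    (hw : w ∈ Set.Ioo (0 : ℝ) 1) : PositiveUnitSum (cons w ((1 - w) • p)) := by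
  refine ⟨fun i => ?_, ?_⟩
  · cases i with
    | zero => exact hw.1
    | succ i => exact mul_pos (sub_pos.2 hw.2) (hp.1 i)
  · have := hasSum_cons w (hp.2.const_smul (1 - w))
    rw [smul_eq_mul, mul_one, add_sub_cancel] at this
    exact this

/-- The law of a sequence with a uniform active part `y`, the other parts being `1 - y` times
an independent Poisson–Dirichlet(1) partition. -/
noncomputable def uniformHeadLaw : Measure (ℕ → ℝ) :=
  gemOne.map fun g => cons (g 0) (decreasingRearrangement (tail g))

instance : IsProbabilityMeasure uniformHeadLaw :=
  Measure.isProbabilityMeasure_map (Measurable.aemeasurable (by fun_prop))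

/-- The expectation of `F` given that the active part is `y`. -/
noncomputable def headIntegral (F : (ℕ → ℝ) → ℝ≥0∞) (y : ℝ) : ℝ≥0∞ :=
  ∫⁻ g, F (cons y (decreasingRearrangement ((1 - y) • g))) ∂gemOne

/-- The expectation of `F` given that the active part is `y`, and that the first stick
broken off the remaining mass is `x`. -/
noncomputable def twoPartIntegral (F : (ℕ → ℝ) → ℝ≥0∞) (y x : ℝ) : ℝ≥0∞ :=
  ∫⁻ g, F (cons y (decreasingRearrangement (cons x ((1 - y - x) • g)))) ∂gemOne

section Integrals

variable {F : (ℕ → ℝ) → ℝ≥0∞}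

@[fun_prop]
lemma measurable_headIntegral (hF : Measurable F) : Measurable (headIntegral F) := by
  have : Measurable fun z : ℝ × (ℕ → ℝ) =>
      F (cons z.1 (decreasingRearrangement ((1 - z.1) • z.2))) := by fun_prop
  exact this.lintegral_prod_right'

lemma measurable_twoPartIntegral (hF : Measurable F) :
    Measurable (Function.uncurry (twoPartIntegral F)) := by
  have : Measurable fun z : (ℝ × ℝ) × (ℕ → ℝ) =>
      F (cons z.1.1 (decreasingRearrangement (cons z.1.2 ((1 - z.1.1 - z.1.2) • z.2)))) := by
    fun_prop
  exact this.lintegral_prod_right'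

lemma lintegral_uniformHeadLaw (hF : Measurable F) :
    ∫⁻ c, F c ∂uniformHeadLaw = ∫⁻ y, headIntegral F y ∂uniform01 := by
  rw [uniformHeadLaw, lintegral_map hF (by fun_prop), lintegral_gemOne (by fun_prop)]
  rfl

lemma headIntegral_eq_lintegral_twoPartIntegral (hF : Measurable F) (y : ℝ) :
    headIntegral F y = ∫⁻ b, twoPartIntegral F y ((1 - y) * b) ∂uniform01 := by
  rw [headIntegral, lintegral_gemOne (by fun_prop)]
  congr 1 with b
  rw [twoPartIntegral]
  congr 1 with g
  rw [smul_cons, smul_smul]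
  congr 5
  ring

/-- Both the key fact and the invariance split an expectation into these two weighted pieces, which
recombine because `(1 - y) + y = 1`. -/
lemma lintegral_mul_headIntegral_add (hF : Measurable F) :
    ∫⁻ y, ENNReal.ofReal (1 - y) * headIntegral F y ∂uniform01 +
      ∫⁻ y, ENNReal.ofReal y * headIntegral F y ∂uniform01 = ∫⁻ c, F c ∂uniformHeadLaw := by
  rw [← lintegral_add_left (by fun_prop), lintegral_uniformHeadLaw hF]
  refine lintegral_congr_ae ?_
  filter_upwards [ae_uniform01] with y hy
  rw [← add_mul, ← ENNReal.ofReal_add (sub_nonneg.2 hy.2.le) hy.1.le, sub_add_cancel,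
    ENNReal.ofReal_one, one_mul]

lemma lintegral_stirringLaw_rearrangement (hF : Measurable F) :
    ∫⁻ c, F c ∂stirringLaw = ∫⁻ g, ∑' i, ENNReal.ofReal (decreasingRearrangement g i) *
      F (cons (decreasingRearrangement g i) (delete i (decreasingRearrangement g))) ∂gemOne := by
  have hm : Measurable fun x : (ℕ → ℝ) × ℝ => F (activateSizeBiased x.1 x.2) :=
    hF.comp measurable_activateSizeBiased
  rw [stirringLaw, lintegral_map hF measurable_activateSizeBiased,
    lintegral_prod _ hm.aemeasurable, poissonDirichletOne,
    lintegral_map hm.lintegral_prod_right' measurable_decreasingRearrangement]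
  refine lintegral_congr_ae ?_
  filter_upwards [ae_gemOne] with g hg
  exact hg.rearrangement.lintegral_sizeBiasedIndex fun i => F (cons (decreasingRearrangement g i)
    (delete i (decreasingRearrangement g)))

lemma lintegral_stirringLaw (hF : Measurable F) :
    ∫⁻ c, F c ∂stirringLaw = ∫⁻ g, ∑' i, ENNReal.ofReal (g i) *
      F (cons (g i) (decreasingRearrangement (delete i g))) ∂gemOne := by
  rw [lintegral_stirringLaw_rearrangement hF]
  refine lintegral_congr_ae ?_
  filter_upwards [ae_gemOne] with g hg
  exact hg.rankable.tsum_rearrangement fun a s => ENNReal.ofReal a * F (cons a s)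

/-- Self-similarity of stick breaking reduces `n + 1` sticks to `n` sticks of the remainder, for a
modified test function; hence the induction over all `F`. Truncation gives the induction a base
case, at the cost of an inequality only. -/
lemma lintegral_sum_sizeBiased_le (hF : Measurable F) (n : ℕ) :
    ∫⁻ g, ∑ i ∈ Finset.range n, ENNReal.ofReal (g i) *
      F (cons (g i) (decreasingRearrangement (delete i g))) ∂gemOne ≤
        ∫⁻ c, F c ∂uniformHeadLaw := by
  induction n generalizing F with
  | zero => simp
  | succ n ih =>
    -- `G w` evaluates `F` once the partition `c` of the remainder is scaled by `1 - w` and the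
    -- first stick `w` is put back among the non-active parts.
    let G : ℝ → (ℕ → ℝ) → ℝ≥0∞ := fun w c =>
      F (cons ((1 - w) * c 0) (decreasingRearrangement (cons w ((1 - w) • tail c))))
    have hG : ∀ w, Measurable (G w) := fun w => by fun_prop
    have hGhead : ∀ w ∈ Set.Ioo (0 : ℝ) 1, ∫⁻ c, G w c ∂uniformHeadLaw =
        ∫⁻ b, twoPartIntegral F ((1 - w) * b) w ∂uniform01 := by
      intro w hw
      rw [lintegral_uniformHeadLaw (hG w)]
      refine lintegral_congr_ae ?_
      filter_upwards [ae_uniform01] with b hb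
      refine lintegral_congr_ae ?_
      filter_upwards [ae_gemOne] with g hg
      simp only [G, cons_zero, tail_cons]
      rw [(hg.rankable.smul (sub_pos.2 hb.2)).rearrangement_cons w (sub_pos.2 hw.2), smul_smul]
      congr 5
      ring
    have hstep : ∀ w ∈ Set.Ioo (0 : ℝ) 1,
        ∫⁻ g, ∑ i ∈ Finset.range (n + 1), ENNReal.ofReal (cons w ((1 - w) • g) i) *
          F (cons (cons w ((1 - w) • g) i)
            (decreasingRearrangement (delete i (cons w ((1 - w) • g))))) ∂gemOne ≤
        ENNReal.ofReal (1 - w) * ∫⁻ b, twoPartIntegral F ((1 - w) * b) w ∂uniform01 +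
          ENNReal.ofReal w * headIntegral F w := by
      intro w hw
      have h1w : 0 < 1 - w := sub_pos.2 hw.2
      rw [← hGhead w hw]
      have heq : ∀ᵐ g ∂gemOne,
          ∑ i ∈ Finset.range (n + 1), ENNReal.ofReal (cons w ((1 - w) • g) i) *
            F (cons (cons w ((1 - w) • g) i)
              (decreasingRearrangement (delete i (cons w ((1 - w) • g))))) =
          ENNReal.ofReal (1 - w) * ∑ i ∈ Finset.range n, ENNReal.ofReal (g i) *
              G w (cons (g i) (decreasingRearrangement (delete i g))) +
            ENNReal.ofReal w * F (cons w (decreasingRearrangement ((1 - w) • g))) := by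
        filter_upwards [ae_gemOne] with g hg
        rw [Finset.sum_range_succ', Finset.mul_sum, cons_zero, delete_zero, tail_cons]
        congr 1
        refine Finset.sum_congr rfl fun i _ => ?_
        simp only [G, cons_zero, tail_cons]
        rw [cons_succ, delete_succ_cons, delete_smul,
          (hg.rankable.delete i).rearrangement_cons w h1w, Pi.smul_apply, smul_eq_mul,
          ENNReal.ofReal_mul h1w.le, mul_assoc]
      rw [lintegral_congr_ae heq, lintegral_add_left (by fun_prop),
        lintegral_const_mul _ (by fun_prop), lintegral_const_mul _ (by fun_prop)]
      exact add_le_add (mul_le_mul_right (ih (hG w)) _) le_rfl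
    rw [lintegral_gemOne (by fun_prop)]
    refine (lintegral_mono_ae (ae_uniform01.mono hstep)).trans_eq ?_
    -- The selected part and the first stick trade places, so the first stick becomes the first
    -- piece broken off after removing the selected part.
    rw [lintegral_add_right _ (by fun_prop),
      lintegral_triangle_swap (measurable_twoPartIntegral hF)]
    simp only [← headIntegral_eq_lintegral_twoPartIntegral hF]
    exact lintegral_mul_headIntegral_add hF

end Integrals

/-- A size-biased part of a Poisson–Dirichlet(1) partition is uniform, and the other parts are
a rescaled independent Poisson–Dirichlet(1) partition. -/
theorem stirringLaw_eq_uniformHeadLaw : stirringLaw = uniformHeadLaw := by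
  -- Both measures have mass one, so domination on measurable sets already forces equality; the
  -- bounds on partial sums are therefore enough.
  refine Measure.eq_of_le_of_isProbabilityMeasure (Measure.le_iff.2 fun s hs => ?_)
  have hF : Measurable (s.indicator (1 : (ℕ → ℝ) → ℝ≥0∞)) := measurable_one.indicator hs
  rw [← lintegral_indicator_one hs, ← lintegral_indicator_one hs, lintegral_stirringLaw hF]
  have hm : ∀ i, Measurable fun g : ℕ → ℝ => ENNReal.ofReal (g i) *
      s.indicator (1 : (ℕ → ℝ) → ℝ≥0∞) (cons (g i) (decreasingRearrangement (delete i g))) :=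
    fun i => by fun_prop
  rw [lintegral_tsum fun i => (hm i).aemeasurable]
  refine ENNReal.tsum_le_of_sum_range_le fun n => ?_
  rw [← lintegral_finsetSum _ fun i _ => hm i]
  exact lintegral_sum_sizeBiased_le hF n

/-! ### Support of the law and invariance -/

lemma ae_stirringLaw : ∀ᵐ c ∂stirringLaw, c ∈ rankedStates := by
  -- This stronger condition is a countable conjunction of measurable ones, as needed to transfer it
  -- through the image measure.
  have h : ∀ᵐ c ∂stirringLaw, PositiveUnitSum c ∧ ∀ m, c (m + 2) ≤ c (m + 1) := by
    rw [stirringLaw_eq_uniformHeadLaw, uniformHeadLaw, ae_map_iff]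
    · filter_upwards [ae_gemOne] with g hg
      have htail : Rankable (tail g) := delete_zero g ▸ hg.rankable.delete 0
      refine ⟨⟨fun i => ?_, ?_⟩, fun m => htail.antitone m.le_succ⟩
      · cases i with
        | zero => exact hg.1 0
        | succ i => exact htail.pos i
      · have h1 : HasSum (tail g) (1 - g 0) := by
          have := (hasSum_nat_add_iff' (f := g) 1).2 hg.2
          rwa [Finset.sum_range_one] at this
        simpa using hasSum_cons (g 0) (htail.hasSum h1)
    · exact Measurable.aemeasurable (by fun_prop)
    · refine measurableSet_positiveUnitSum.inter (measurableSet_forall fun m => ?_)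
      exact measurableSet_le (measurable_pi_apply _) (measurable_pi_apply _)
  filter_upwards [h] with c hc
  refine ⟨fun m => (hc.1.1 m).le, fun m n hm hmn => ?_, hc.1.2⟩
  have := antitone_nat_of_succ_le (f := fun k => c (k + 1)) hc.2 (Nat.sub_le_sub_right hmn 1)
  simpa [Nat.sub_add_cancel hm, Nat.sub_add_cancel (hm.trans hmn)] using this

/-- The contributions of a split and of a merge to the transform of a sequence whose active part
is `w`. -/
lemma headIntegral_splitMerge {F : (ℕ → ℝ) → ℝ≥0∞} (hF : Measurable F) {w : ℝ}
    (hw : w ∈ Set.Ioo (0 : ℝ) 1) :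
    headIntegral (fun c => ∫⁻ u, F (splitMerge c u) ∂uniform01) w =
      ∫⁻ u, (if u ≤ w then twoPartIntegral F u (w - u) else 0) ∂uniform01 +
        ENNReal.ofReal (1 - w) * ∫⁻ b, headIntegral F (w + (1 - w) * b) ∂uniform01 := by
  have h1w : 0 < 1 - w := sub_pos.2 hw.2
  -- `G` evaluates `F` after a merge, where `c` is the partition of the remainder, rescaled to mass
  -- one, with the part to be absorbed in front.
  let G : (ℕ → ℝ) → ℝ≥0∞ := fun c => F (cons (w + (1 - w) * c 0) ((1 - w) • tail c))
  have hG : Measurable G := by fun_prop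
  have hsplit : Measurable fun z : (ℕ → ℝ) × ℝ => if z.2 ≤ w then
      F (cons z.2 (decreasingRearrangement (cons (w - z.2) ((1 - w) • z.1)))) else 0 :=
    Measurable.ite (measurableSet_le (by fun_prop) (by fun_prop)) (by fun_prop) measurable_const
  have heq : ∀ᵐ g ∂gemOne,
      ∫⁻ u, F (splitMerge (cons w (decreasingRearrangement ((1 - w) • g))) u) ∂uniform01 =
      ∫⁻ u, (if u ≤ w then
        F (cons u (decreasingRearrangement (cons (w - u) ((1 - w) • g)))) else 0) ∂uniform01 +
      ENNReal.ofReal (1 - w) * ∑' i, ENNReal.ofReal (decreasingRearrangement g i) *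
        G (cons (decreasingRearrangement g i) (delete i (decreasingRearrangement g))) := by
    filter_upwards [ae_gemOne] with g hg
    rw [hg.rankable.rearrangement_smul h1w, (hg.rearrangement.cons hw).lintegral_splitMerge hF,
      ← ENNReal.tsum_mul_left]
    congr 1
    · congr 1 with u
      simp only [cons_zero, split, cons_succ]
      rw [← hg.rankable.rearrangement_cons (w - u) h1w]
      rfl
    · congr 1 with i
      simp only [cons_zero, cons_succ, tail_cons, G, Pi.smul_apply, smul_eq_mul, delete_smul]
      rw [ENNReal.ofReal_mul h1w.le, mul_assoc]
  -- The absorbed part is size-biased in the remainder, so the key fact applies a second time: it is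
  -- uniform, and the parts left over have mass `(1 - w) * (1 - b) = 1 - (w + (1 - w) * b)`.
  rw [headIntegral, lintegral_congr_ae heq, lintegral_add_left hsplit.lintegral_prod_right',
    lintegral_const_mul _ (by fun_prop), ← lintegral_stirringLaw_rearrangement hG,
    stirringLaw_eq_uniformHeadLaw, lintegral_uniformHeadLaw hG,
    lintegral_lintegral_swap (f := fun g u => if u ≤ w then
      F (cons u (decreasingRearrangement (cons (w - u) ((1 - w) • g)))) else 0)
      hsplit.aemeasurable]
  congr 1
  · congr 1 with u
    split_ifs with hu
    · rw [twoPartIntegral, sub_sub_sub_cancel_right]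
    · simp
  · congr 1
    refine lintegral_congr_ae ?_
    filter_upwards [ae_uniform01] with b hb
    refine lintegral_congr_ae ?_
    filter_upwards [ae_gemOne] with g hg
    simp only [G, cons_zero, tail_cons]
    rw [← (hg.rankable.smul (sub_pos.2 hb.2)).rearrangement_smul h1w, smul_smul]
    congr 4
    ring

/-- The split-and-merge transformation preserves `stirringLaw`. -/
theorem map_splitMerge :
    (stirringLaw.prod uniform01).map (fun x => splitMerge x.1 x.2) = stirringLaw := by
  refine Measure.ext_of_lintegral _ fun F hF => ?_
  have hm : Measurable fun x : (ℕ → ℝ) × ℝ => F (splitMerge x.1 x.2) :=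
    hF.comp measurable_splitMerge
  rw [lintegral_map hF measurable_splitMerge, lintegral_prod _ hm.aemeasurable,
    stirringLaw_eq_uniformHeadLaw, lintegral_uniformHeadLaw hm.lintegral_prod_right',
    ← lintegral_mul_headIntegral_add hF]
  have h := measurable_headIntegral hF
  have hhead : Measurable fun z : ℝ × ℝ => headIntegral F (z.1 + (1 - z.1) * z.2) := by fun_prop
  have hhead' := hhead.lintegral_prod_right' (ν := uniform01)
  -- Splits produce the piece with weight `1 - y`, merges the piece with weight `y`.
  rw [lintegral_congr_ae (ae_uniform01.mono fun w hw => headIntegral_splitMerge hF hw),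
    lintegral_add_right _ (by fun_prop), lintegral_triangle_add h,
    lintegral_triangle_sub (measurable_twoPartIntegral hF)]
  simp only [← headIntegral_eq_lintegral_twoPartIntegral hF]

end Stirring

/-- The law `μ` is a probability measure on ranked sequences, and if `C` has law `μ` and `U` is
uniform on `[0, 1]` and independent of `C`, then the split-and-merge transform of `C` driven by `U`
has law `μ` again. -/
theorem theorem2 :
    IsProbabilityMeasure Stirring.stirringLaw ∧
    (∀ᵐ c ∂Stirring.stirringLaw, c ∈ Stirring.rankedStates) ∧
    ∀ {Ω : Type*} [MeasurableSpace Ω] (P : Measure Ω) [IsProbabilityMeasure P]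
      (C : Ω → ℕ → ℝ) (U : Ω → ℝ),
      HasLaw C Stirring.stirringLaw P → HasLaw U Stirring.uniform01 P → IndepFun C U P →
      HasLaw (fun ω => Stirring.splitMerge (C ω) (U ω)) Stirring.stirringLaw P := by
  refine ⟨inferInstance, Stirring.ae_stirringLaw, ?_⟩
  intro Ω _ P _ C U hC hU hCU
  have hpair : AEMeasurable (fun ω => (C ω, U ω)) P := hC.aemeasurable.prodMk hU.aemeasurable
  refine ⟨Stirring.measurable_splitMerge.comp_aemeasurable hpair, ?_⟩
  have h := (indepFun_iff_map_prod_eq_prod_map_map hC.aemeasurable hU.aemeasurable).1 hCU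
  rw [hC.map_eq, hU.map_eq] at h
  have h2 := AEMeasurable.map_map_of_aemeasurable
    Stirring.measurable_splitMerge.aemeasurable hpair
  rw [h, Stirring.map_splitMerge] at h2
  exact h2.symm
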